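/- **Setting.** Let $n\ge 1$, $X\subseteq\mathbb R^n$, $S\subseteq\mathbb R^m$ (such that derivatives on $X\times S$ are unique, e.g. open sets or nondegenerate boxes), and let $H:X\times S\to\mathbb R^n$ be differentiable with Lipschitz continuous derivative; $H'_x$ denotes the Jacobian with respect to $x$. Let $\mathbf x\subseteq X$, $\mathbf s\subseteq S$ be boxes, $z\in\mathbf x$, $p\in\mathbf s$, and let $\hat x:\mathbb R^m\to\mathbb R^n$ be continuously differentiable with $\hat x(p)=z$ and $\hat x(s)\in\mathbf x$ for $s\in\mathbf s$. Put $g(s)=(\hat x(s),s)$. Absolute values and inequalities of vectors, matrices and 3-tensors are componentwise; $(\mathcal Tv)_{ij}=\sum_k\mathcal T_{ijk}v_k$, $(C\mathcal T)_{ijk}=\sum_l C_{il}\mathcal T_{ljk}$, $(\mathcal TB)_{ijk}=\sum_l\mathcal T_{ijl}B_{lk}$, and $v^T\mathcal Tv=(\mathcal Tv)v$. A slope of $F$ with center $q$ at $q'$ is a matrix (a 3-tensor, if $F$ is matrix-valued) $F[q,q']$ with $F(q')-F(q)=F[q,q'](q'-q)$. Let $C\in\mathbb R^{n\times n}$. For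 $s\in\mathbf s$ and $x\in\mathbf x$ fix slopes $\hat x[p,s]$, $CH[g(p),g(s)]$, $H'_x[g(p),g(s)]$, and second order slopes $H_{xx}(x,s)\in\mathbb R^{n\times n\times n}$, i.e. tensors with $$H(x,s)-H(\hat x(s),s)=\bigl(H'_x(g(s))+H_{xx}(x,s)\,(x-\hat x(s))\bigr)(x-\hat x(s)).$$ Put $g[p,s]=\binom{\hat x[p,s]}{1}$, $G_0(s)=|CH[g(p),g(s)]|\,|g[p,s]|$ and $A(s)=|C\,H'_x[g(p),g(s)]|\,|g[p,s]|$. **Bounds.** Let $\bar b\ge|CH(z,p)|$ and $B_0\ge|CH'_x(z,p)-1|$. Suppose that for all $s\in\mathbf s$, $x\in\mathbf x$ $$|C\,H_{xx}(x,s)|\le\mathfrak B(s)\le\bar{\mathfrak B},\qquad G_0(s)\le\bar G_0,\qquad A(s)\le\bar A .$$ Let $0<v\in\mathbb R^n$ and $0<y\in\mathbb R^m$, and put $$\begin{gathered}w=(1-B_0)v,\quad \bar{\mathfrak a}=v^T\bar{\mathfrak B}v,\quad \mathfrak a(s)=v^T\mathfrak B(s)v,\\ \alpha_j=((\bar Ay)v)_j,\quad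 \beta_j=\alpha_jw_j+2\bar{\mathfrak a}_j(\bar G_0y)_j,\quad \gamma_j=w_j^2-4\bar{\mathfrak a}_j\bar b_j .\end{gathered}$$ Assume $w_j>0$, $\alpha_j>0$ and $\mathfrak a_j(s)>0$ for all $j$ and all $s\in\mathbf s$. **Parameters at $s\in\mathbf s$.** Let $\bar{\mathfrak b}(s)=\bar b+G_0(s)|s-p|$, $\mathfrak B_0(s)=B_0+A(s)|s-p|$, $\mathfrak w(s)=(1-\mathfrak B_0(s))v$, $D_j(s)=\mathfrak w_j(s)^2-4\mathfrak a_j(s)\bar{\mathfrak b}_j(s)$, $$\begin{gathered}\lambda^e_j(s)=\frac{\mathfrak w_j(s)+\sqrt{D_j(s)}}{2\mathfrak a_j(s)},\quad \lambda^i_j(s)=\frac{\bar{\mathfrak b}_j(s)}{\mathfrak a_j(s)\lambda^e_j(s)},\quad \lambda^e_s=\min_j\lambda^e_j(s),\quad \lambda^i_s=\max_j\lambda^i_j(s),\\ \mathbf R^i_s=[\hat x(s)-\lambda^i_sv,\ \hat x(s)+\lambda^i_sv],\qquad \mathbf R^e_s=[\hat x(s)-\lambda^e_sv,\ \hat x(s)+\lambda^e_sv]\cap\mathbf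 x .\end{gathered}$$ **Parameters at radius $r\ge0$.** Let $\bar{\mathfrak b}(r)=\bar b+r\bar G_0y$, $\mathfrak w(r)=(1-B_0-r\bar Ay)v$, $\underline D_j(r)=\mathfrak w_j(r)^2-4\bar{\mathfrak a}_j\bar{\mathfrak b}_j(r)=\alpha_j^2r^2-2\beta_jr+\gamma_j$, and $$\lambda^e_{(r)}=\min_j\lambda^e_{j}(r),\quad \lambda^e_{j}(r)=\frac{\mathfrak w_j(r)+\sqrt{\underline D_j(r)}}{2\bar{\mathfrak a}_j},\qquad \lambda^i_{(r)}=\max_j\frac{\bar{\mathfrak b}_j(r)}{\bar{\mathfrak a}_j\lambda^e_{j}(r)} .$$ Put $\bar\mu_j=\dfrac{\beta_j+\sqrt{\beta_j^2-\alpha_j^2\gamma_j}}{\alpha_j^2}$, $\underline\mu_j=\dfrac{\gamma_j}{\alpha_j^2\bar\mu_j}$ and $\underline\mu=\min_j\underline\mu_j$. Let $\eta$ be the supremum of the set (assumed nonempty) of $r\in[0,\underline\mu]$ with $\lambda^e_{(r)}>\lambda^i_{(r)}$, and let $\sigma$ be the largest $r\in[0,\underline\mu]$ such that $\hat x_j(s')+[-1,1]\,\lambda^i_{(r)}v_j\subseteq\mathbf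 x_j$ for all $j$ and all $s'\in[p-ry,p+ry]$. **Theorem.** If $\mu=\min(\eta,\sigma)>0$, then for every $s\in\mathbf s$ in the interior of $\{s:|s-p|\le\mu y\}$ one has $D_j(s)>0$ for all $j$, $\lambda^i_s<\lambda^e_s$ and $\mathbf R^i_s\subseteq\mathbf x$; there is at least one $x\in\mathbf R^i_s$ with $H(x,s)=0$; and $H(\cdot,s)$ has no zero in $\operatorname{int}(\mathbf R^e_s)\setminus\mathbf R^i_s$. -/

import Mathlib

noncomputable section

namespace ExclusionRegions

/-! ### Third order tensors and componentwise absolute values -/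

/-- A real third order tensor. -/
abbrev Tensor (ι κ τ : Type*) : Type _ := ι → κ → τ → ℝ

/-- `(𝒯 v)_{ij} = ∑ₖ 𝒯_{ijk} vₖ`. -/
def tensorMulVec {ι κ τ : Type*} [Fintype τ] (T : Tensor ι κ τ) (v : τ → ℝ) : Matrix ι κ ℝ :=
  Matrix.of fun i j => ∑ k, T i j k * v k

/-- `(C 𝒯)_{ijk} = ∑ₗ C_{il} 𝒯_{ljk}`. -/
def matMulTensor {ι ι' κ τ : Type*} [Fintype ι] (C : Matrix ι' ι ℝ) (T : Tensor ι κ τ) :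
    Tensor ι' κ τ :=
  fun i j k => ∑ l, C i l * T l j k

/-- `(𝒯 B)_{ijk} = ∑ₗ 𝒯_{ijl} B_{lk}`. -/
def tensorMulMat {ι κ τ τ' : Type*} [Fintype τ] (T : Tensor ι κ τ) (B : Matrix τ τ' ℝ) :
    Tensor ι κ τ' :=
  fun i j k => ∑ l, T i j l * B l k

/-- `vᵀ 𝒯 v = (𝒯 v) v`. -/
def tensorQuad {ι κ : Type*} [Fintype κ] (v : κ → ℝ) (T : Tensor ι κ κ) : ι → ℝ :=
  (tensorMulVec T v).mulVec v

/-- Componentwise absolute value of a vector. -/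
def absVec {ι : Type*} (x : ι → ℝ) : ι → ℝ := fun i => |x i|

/-- Componentwise absolute value of a matrix. -/
def absMat {ι κ : Type*} (M : Matrix ι κ ℝ) : Matrix ι κ ℝ := M.map fun r => |r|

/-- Componentwise absolute value of a tensor. -/
def absTensor {ι κ τ : Type*} (T : Tensor ι κ τ) : Tensor ι κ τ := fun i j k => |T i j k|

/-! ### The domain, the partial Jacobian, and slopes

A point `(x, s)` of `ℝⁿ × ℝᵐ` is the vector `Sum.elim x s`, indexed by `Fin n ⊕ Fin m`. -/

/-- The set `X × S`. -/
def prodDomain {n m : ℕ} (X : Set (Fin n → ℝ)) (S : Set (Fin m → ℝ)) :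
    Set (Fin n ⊕ Fin m → ℝ) :=
  {q | q ∘ Sum.inl ∈ X ∧ q ∘ Sum.inr ∈ S}

/-- The Jacobian `H'_x` at the point `q` of the domain `D`: the columns of the Jacobian of `H`
that belong to the variable `x`. -/
def jacX {n m : ℕ} (H : (Fin n ⊕ Fin m → ℝ) → Fin n → ℝ) (D : Set (Fin n ⊕ Fin m → ℝ))
    (q : Fin n ⊕ Fin m → ℝ) : Matrix (Fin n) (Fin n) ℝ :=
  Matrix.of fun i j => fderivWithin ℝ H D q (Pi.single (Sum.inl j) 1) i

/-- `M` is a slope matrix for `F` with center `z` at `x`. -/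
def IsSlope {ι κ : Type*} [Fintype κ] (F : (κ → ℝ) → ι → ℝ) (z x : κ → ℝ)
    (M : Matrix ι κ ℝ) : Prop :=
  F x - F z = M.mulVec (x - z)

/-- `T` is a slope for the matrix-valued function `F` with center `z` at `x`. -/
def IsMatrixSlope {ι κ τ : Type*} [Fintype τ] (F : (τ → ℝ) → Matrix ι κ ℝ) (z x : τ → ℝ)
    (T : Tensor ι κ τ) : Prop :=
  F x - F z = tensorMulVec T (x - z)

/-- `T` is a second order slope for `F` with double center `z` at `x`, where `J` is the Jacobian
of `F` at `z`: the matrix `J + T (x - z)` is a slope matrix for `F` with center `z` at `x`. -/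
def IsSecondSlope {ι κ : Type*} [Fintype κ] (F : (κ → ℝ) → ι → ℝ) (J : Matrix ι κ ℝ)
    (z x : κ → ℝ) (T : Tensor ι κ κ) : Prop :=
  IsSlope F z x (J + tensorMulVec T (x - z))

/-- The curve `g(s) = (x̂(s), s)`. -/
def curve {n m : ℕ} (xhat : (Fin m → ℝ) → Fin n → ℝ) (s : Fin m → ℝ) : Fin n ⊕ Fin m → ℝ :=
  Sum.elim (xhat s) s

/-- The slope matrix for `g` which belongs to the slope matrix `M` for `x̂`: the rows of `M` above
the identity matrix. -/
def curveSlope {n m : ℕ} (M : Matrix (Fin n) (Fin m) ℝ) : Matrix (Fin n ⊕ Fin m) (Fin m) ℝ :=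
  Matrix.fromRows M 1

/-- `G₀ = |M| |g[p,s]|`, with `M` a slope matrix for `C H ` and `N` one for `x̂`. -/
def slopeG₀ {n m : ℕ} (M : Matrix (Fin n) (Fin n ⊕ Fin m) ℝ) (N : Matrix (Fin n) (Fin m) ℝ) :
    Matrix (Fin n) (Fin m) ℝ :=
  absMat M * absMat (curveSlope N)

/-- `A = |C T| |g[p,s]|`, with `T` a slope for `H'_x` and `N` a slope matrix for `x̂`. -/
def slopeA {n m : ℕ} (C : Matrix (Fin n) (Fin n) ℝ) (T : Tensor (Fin n) (Fin n) (Fin n ⊕ Fin m))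
    (N : Matrix (Fin n) (Fin m) ℝ) : Tensor (Fin n) (Fin n) (Fin m) :=
  tensorMulMat (absTensor (matMulTensor C T)) (absMat (curveSlope N))

/-! ### Inclusion and exclusion parameters

The following are functions of a triple of bounds `b`, `B₀`, `B` (on the preconditioned function
value, on the deviation of the preconditioned Jacobian from the identity, and on the
preconditioned second order slopes), and of the scaling vector `v`. -/

/-- `b + G t`. -/
def bAt {n m : ℕ} (b : Fin n → ℝ) (G : Matrix (Fin n) (Fin m) ℝ) (t : Fin m → ℝ) : Fin n → ℝ :=
  b + G.mulVec t

/-- `B₀ + A t`. -/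
def B₀At {n m : ℕ} (B₀ : Matrix (Fin n) (Fin n) ℝ) (A : Tensor (Fin n) (Fin n) (Fin m))
    (t : Fin m → ℝ) : Matrix (Fin n) (Fin n) ℝ :=
  B₀ + tensorMulVec A t

/-- `w = (1 - B₀) v`. -/
def wVec {n : ℕ} (v : Fin n → ℝ) (B₀ : Matrix (Fin n) (Fin n) ℝ) : Fin n → ℝ :=
  (1 - B₀).mulVec v

/-- `a = vᵀ B v`. -/
def aVec {n : ℕ} (v : Fin n → ℝ) (B : Tensor (Fin n) (Fin n) (Fin n)) : Fin n → ℝ :=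
  tensorQuad v B

/-- `D_j = w_j² - 4 a_j b_j`. -/
def disc {n : ℕ} (v b : Fin n → ℝ) (B₀ : Matrix (Fin n) (Fin n) ℝ)
    (B : Tensor (Fin n) (Fin n) (Fin n)) (j : Fin n) : ℝ :=
  wVec v B₀ j ^ 2 - 4 * aVec v B j * b j

/-- `λᵉ_j = (w_j + √D_j) / (2 a_j)`. -/
def lamEj {n : ℕ} (v b : Fin n → ℝ) (B₀ : Matrix (Fin n) (Fin n) ℝ)
    (B : Tensor (Fin n) (Fin n) (Fin n)) (j : Fin n) : ℝ :=
  (wVec v B₀ j + √(disc v b B₀ B j)) / (2 * aVec v B j)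

/-- `λⁱ_j = b_j / (a_j λᵉ_j)`. -/
def lamIj {n : ℕ} (v b : Fin n → ℝ) (B₀ : Matrix (Fin n) (Fin n) ℝ)
    (B : Tensor (Fin n) (Fin n) (Fin n)) (j : Fin n) : ℝ :=
  b j / (aVec v B j * lamEj v b B₀ B j)

/-- `λᵉ = min_j λᵉ_j`. -/
def lamE {n : ℕ} (v b : Fin n → ℝ) (B₀ : Matrix (Fin n) (Fin n) ℝ)
    (B : Tensor (Fin n) (Fin n) (Fin n)) : ℝ :=
  ⨅ j, lamEj v b B₀ B j

/-- `λⁱ = max_j λⁱ_j`. -/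
def lamI {n : ℕ} (v b : Fin n → ℝ) (B₀ : Matrix (Fin n) (Fin n) ℝ)
    (B : Tensor (Fin n) (Fin n) (Fin n)) : ℝ :=
  ⨆ j, lamIj v b B₀ B j

/-- The box `[c - r v, c + r v]`. -/
def box {n : ℕ} (c v : Fin n → ℝ) (r : ℝ) : Set (Fin n → ℝ) :=
  Set.Icc (c - r • v) (c + r • v)

/-! ### The coefficients of the discriminant as a function of the radius -/

/-- `α_j = ((A y) v)_j`. -/
def alpha {n m : ℕ} (v : Fin n → ℝ) (y : Fin m → ℝ) (A : Tensor (Fin n) (Fin n) (Fin m)) :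
    Fin n → ℝ :=
  (tensorMulVec A y).mulVec v

/-- `β_j = α_j w_j + 2 a_j (G y)_j`. -/
def beta {n m : ℕ} (v : Fin n → ℝ) (y : Fin m → ℝ) (B₀ : Matrix (Fin n) (Fin n) ℝ)
    (G : Matrix (Fin n) (Fin m) ℝ) (A : Tensor (Fin n) (Fin n) (Fin m))
    (B : Tensor (Fin n) (Fin n) (Fin n)) (j : Fin n) : ℝ :=
  alpha v y A j * wVec v B₀ j + 2 * aVec v B j * G.mulVec y j

/-- `γ_j = w_j² - 4 a_j b_j`. -/
def gamma {n : ℕ} (v b : Fin n → ℝ) (B₀ : Matrix (Fin n) (Fin n) ℝ)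
    (B : Tensor (Fin n) (Fin n) (Fin n)) (j : Fin n) : ℝ :=
  wVec v B₀ j ^ 2 - 4 * aVec v B j * b j

/-- The larger root `(β + √(β² - α² γ)) / α²` of `α² μ² - 2 β μ + γ`. -/
def muUpper (α β γ : ℝ) : ℝ := (β + √(β ^ 2 - α ^ 2 * γ)) / α ^ 2

/-- The smaller root of `α² μ² - 2 β μ + γ`, as `γ / (α² μ')` with `μ'` the larger root. -/
def muLower (α β γ : ℝ) : ℝ := γ / (α ^ 2 * muUpper α β γ)

/-- The minimum over `j` of the smaller roots. -/
def muMin {n m : ℕ} (v : Fin n → ℝ) (y : Fin m → ℝ) (b : Fin n → ℝ)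
    (B₀ : Matrix (Fin n) (Fin n) ℝ) (G : Matrix (Fin n) (Fin m) ℝ)
    (A : Tensor (Fin n) (Fin n) (Fin m)) (B : Tensor (Fin n) (Fin n) (Fin n)) : ℝ :=
  ⨅ j, muLower (alpha v y A j) (beta v y B₀ G A B j) (gamma v b B₀ B j)

theorem tensorMulVec_smul {ι κ τ : Type*} [Fintype τ] (T : Tensor ι κ τ) (r : ℝ) (v : τ → ℝ) :
    tensorMulVec T (r • v) = r • tensorMulVec T v := by
  ext i j
  simp only [tensorMulVec, Matrix.of_apply, Matrix.smul_apply, Pi.smul_apply, smul_eq_mul,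
    Finset.mul_sum]
  exact Finset.sum_congr rfl fun k _ => by ring

/-- With the bounds `b + μ G y` and `B₀ + μ A y`, the discriminant is
`α_j² μ² - 2 β_j μ + γ_j`. -/
theorem disc_eq_quadratic {n m : ℕ} (v : Fin n → ℝ) (y : Fin m → ℝ) (b : Fin n → ℝ)
    (B₀ : Matrix (Fin n) (Fin n) ℝ) (G : Matrix (Fin n) (Fin m) ℝ)
    (A : Tensor (Fin n) (Fin n) (Fin m)) (B : Tensor (Fin n) (Fin n) (Fin n)) (μ : ℝ)
    (j : Fin n) :
    disc v (bAt b G (μ • y)) (B₀At B₀ A (μ • y)) B j =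
      alpha v y A j ^ 2 * μ ^ 2 - 2 * beta v y B₀ G A B j * μ + gamma v b B₀ B j := by
  have h1 : wVec v (B₀At B₀ A (μ • y)) j = wVec v B₀ j - μ * alpha v y A j := by
    simp only [wVec, B₀At, alpha, tensorMulVec_smul, Matrix.sub_mulVec, Matrix.add_mulVec,
      Matrix.smul_mulVec, Pi.sub_apply, Pi.add_apply, Pi.smul_apply, smul_eq_mul]
    ring
  have h2 : bAt b G (μ • y) j = b j + μ * G.mulVec y j := by
    simp [bAt, Matrix.mulVec_smul]
  rw [disc, h1, h2, beta, gamma]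
  ring

end ExclusionRegions

end

/-! ### Brouwer's fixed point theorem, by a volume argument. -/

section Brouwer

open Polynomial Metric Set MeasureTheory Module
open scoped NNReal

/-! Fix a parameter s and write c = x̂(s). On the box of radius t v around c, the bounds on C H, C
H'_x - 1 and C H_xx give |x - c - C H(x,s)| ≤ t v + q(t) componentwise, where q_j(t) = a_j t² - w_j
t + b_j has the roots λⁱ_j ≤ λᵉ_j (`abs_sub_mulVec_le`, `quadratic_eq_mul`). If λⁱ = max λⁱ_j is
less than λᵉ = min λᵉ_j, every q_j(λⁱ) is nonpositive, so x ↦ x - C H(x,s) maps the inclusion box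
into itself. Its Brouwer fixed point is a zero of H, because C is nonsingular. Conversely, a zero at
scaled distance t from c with λⁱ < t < λᵉ would give t v_j ≤ t v_j + q_j(t) < t v_j for the
coordinate j attaining that distance. This is `exists_zero_and_ne_zero`.

To pass to a whole neighbourhood of p, the bounds at s are compared with the uniform bounds at some
radius r < μ. Worse bounds raise λⁱ and lower λᵉ (`lamIj_mono`, `lamEj_anti`), and `le_muLower`
keeps w and the discriminants positive below the smallest root. Thus the inequality λⁱ < λᵉ and the
inclusion in 𝐱 are inherited from radii near η and from σ.

Brouwer's theorem rests on `no_contDiffOn_retraction_sphere`. For a C¹ retraction r, the map x + t(r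
x - x) is a bijection of the ball for small t, so the integral of its Jacobian determinant is the
volume of the ball. That determinant is polynomial in t, so interpolation gives the same integral at
t = 1, where the determinant of r' vanishes. -/

theorem exists_polynomial_eval_eq_det_one_add_smul {V : Type*} [AddCommGroup V] [Module ℝ V]
    [FiniteDimensional ℝ V] (M : V →ₗ[ℝ] V) :
    ∃ p : ℝ[X], p.natDegree ≤ finrank ℝ V ∧ ∀ t : ℝ, p.eval t = LinearMap.det (1 + t • M) := by
  classical
  let e := finBasis ℝ V
  let A := LinearMap.toMatrix e e M
  refine ⟨((X : ℝ[X]) • A.map C + (1 : Matrix _ _ ℝ).map C).det, ?_, fun t => ?_⟩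
  · simpa using natDegree_det_X_add_C_le A 1
  · rw [← LinearMap.det_toMatrix e, ← coe_evalRingHom, RingHom.map_det]
    congr 1
    ext i j
    by_cases h : i = j
    · subst h; simp [A, LinearMap.toMatrix_one, add_comm]; exact mul_comm _ _
    · simp [A, LinearMap.toMatrix_one, h]; exact mul_comm _ _

/-- Lagrange interpolation of `t ↦ det (1 + t M)` at `t = 1`. -/
theorem det_one_add_eq_sum {V : Type*} [AddCommGroup V] [Module ℝ V]
    [FiniteDimensional ℝ V] (M : V →ₗ[ℝ] V) (τ : ℕ → ℝ) (hτ : Function.Injective τ) :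
    LinearMap.det (1 + M) = ∑ i ∈ Finset.range (finrank ℝ V + 1),
      LinearMap.det (1 + τ i • M) *
        (Lagrange.basis (Finset.range (finrank ℝ V + 1)) τ i).eval 1 := by
  obtain ⟨p, hp, hpt⟩ := exists_polynomial_eval_eq_det_one_add_smul M
  have h := Lagrange.eq_interpolate (f := p) (s := Finset.range (finrank ℝ V + 1)) (v := τ)
    hτ.injOn (lt_of_le_of_lt degree_le_natDegree (by
      rw [Finset.card_range]; exact_mod_cast Nat.lt_succ_of_le hp))
  have h1 : p.eval 1 = LinearMap.det (1 + M) := by rw [hpt, one_smul]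
  rw [← h1]
  conv_lhs => rw [h]
  rw [Lagrange.interpolate_apply, eval_finsetSum]
  refine Finset.sum_congr rfl fun i _ => ?_
  rw [eval_mul, eval_C, hpt]

/-- For 0 ≤ t ≤ 1 the map 1 + t M is injective because ‖t M‖ < 1, so the determinant cannot change
sign on its way from the value 1 at t = 0. -/
theorem det_one_add_pos {E : Type*} [NormedAddCommGroup E] [NormedSpace ℝ E]
    [FiniteDimensional ℝ E] (M : E →L[ℝ] E) (hM : ‖M‖ < 1) :
    0 < LinearMap.det (1 + (M : E →ₗ[ℝ] E)) := by
  obtain ⟨p, -, hpt⟩ := exists_polynomial_eval_eq_det_one_add_smul (M : E →ₗ[ℝ] E)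
  have hne : ∀ t ∈ Icc (0 : ℝ) 1, p.eval t ≠ 0 := by
    intro t ht h0
    rw [hpt] at h0
    obtain ⟨x, hx, hx0⟩ := Submodule.exists_mem_ne_zero_of_ne_bot
      (LinearMap.bot_lt_ker_of_det_eq_zero h0).ne'
    have hx' : x = -(t • M x) := eq_neg_of_add_eq_zero_left (by simpa using hx)
    have h1 : ‖x‖ = t * ‖M x‖ := by
      conv_lhs => rw [hx']
      rw [norm_neg, norm_smul, Real.norm_of_nonneg ht.1]
    have h2 := M.le_opNorm x
    have h3 : 0 < ‖x‖ := norm_pos_iff.2 hx0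
    nlinarith [mul_le_of_le_one_left (norm_nonneg (M x)) ht.2]
  by_contra hcon
  have h0 : p.eval 0 = 1 := by rw [hpt]; simp
  have h1 : p.eval 1 ≤ 0 := by rw [hpt, one_smul]; exact not_lt.1 hcon
  obtain ⟨t, ht, h⟩ := intermediate_value_Icc' zero_le_one (f := fun t => p.eval t)
    p.continuous.continuousOn (show (0 : ℝ) ∈ Icc _ _ from ⟨h1, by rw [h0]; exact zero_le_one⟩)
  exact hne t ht h

/-! ### Small perturbations of the identity on the unit ball. -/

section Perturbation

variable {E : Type*} [NormedAddCommGroup E] [NormedSpace ℝ E]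

theorem exists_mem_sphere_of_mem_of_notMem {x y : E} (hx : x ∈ closedBall (0 : E) 1)
    (hy : y ∉ closedBall (0 : E) 1) : ∃ c ∈ sphere (0 : E) 1, ‖x - c‖ ≤ ‖x - y‖ := by
  have hc : ContinuousOn (fun t : ℝ => ‖x + t • (y - x)‖) (Icc 0 1) := by fun_prop
  rw [mem_closedBall_zero_iff] at hx hy
  obtain ⟨t, ht, h⟩ := intermediate_value_Icc zero_le_one hc
    (show (1 : ℝ) ∈ Icc _ _ from ⟨by simpa using hx, by simpa using (not_le.1 hy).le⟩)
  refine ⟨x + t • (y - x), by simpa using h, ?_⟩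
  rw [sub_add_cancel_left, norm_neg, norm_smul, Real.norm_of_nonneg ht.1, norm_sub_rev y x]
  exact mul_le_of_le_one_left (norm_nonneg _) ht.2

/-- A segment leaving the ball crosses the sphere, where g vanishes, so extension by zero does not
increase the Lipschitz constant. -/
theorem lipschitzWith_indicator_closedBall {g : E → E} {K : ℝ≥0}
    (hg : LipschitzOnWith K g (closedBall 0 1)) (h0 : ∀ x ∈ sphere (0 : E) 1, g x = 0) :
    LipschitzWith K ((closedBall (0 : E) 1).indicator g) := by
  have key : ∀ x ∈ closedBall (0 : E) 1, ∀ y ∉ closedBall (0 : E) 1, ‖g x‖ ≤ K * ‖x - y‖ := by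
    intro x hx y hy
    obtain ⟨c, hc, hxc⟩ := exists_mem_sphere_of_mem_of_notMem hx hy
    have := hg.norm_sub_le hx (sphere_subset_closedBall hc)
    rw [h0 c hc, sub_zero] at this
    exact this.trans (by gcongr)
  refine LipschitzWith.of_dist_le_mul fun x y => ?_
  rw [dist_eq_norm, dist_eq_norm]
  by_cases hx : x ∈ closedBall (0 : E) 1 <;> by_cases hy : y ∈ closedBall (0 : E) 1
  · simpa [indicator_of_mem hx, indicator_of_mem hy] using hg.norm_sub_le hx hy
  · simpa [indicator_of_mem hx, indicator_of_notMem hy] using key x hx y hy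
  · simpa [indicator_of_notMem hx, indicator_of_mem hy, norm_sub_rev x y] using key y hy x hx
  · simp only [indicator_of_notMem hx, indicator_of_notMem hy, sub_zero, norm_zero]
    positivity

/-- Injectivity follows from t K < 1. A preimage of y is a fixed point of the contraction x ↦ y - t
G(x), where G extends r - id by zero; a fixed point outside the ball would equal y, which lies
inside. -/
theorem injOn_image_closedBall_of_lipschitz [CompleteSpace E] {r : E → E} {K : ℝ≥0}
    (hr : LipschitzOnWith K (fun x => r x - x) (closedBall 0 1))
    (h0 : ∀ x ∈ sphere (0 : E) 1, r x = x)
    (hmaps : ∀ x ∈ closedBall (0 : E) 1, r x ∈ closedBall (0 : E) 1)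
    {t : ℝ} (ht0 : 0 ≤ t) (ht1 : t ≤ 1) (htK : t * K < 1) :
    InjOn (fun x => x + t • (r x - x)) (closedBall 0 1) ∧
      (fun x => x + t • (r x - x)) '' closedBall 0 1 = closedBall 0 1 := by
  refine ⟨fun x hx y hy hxy => ?_, subset_antisymm ?_ fun y hy => ?_⟩
  · have h1 : x - y = t • ((r y - y) - (r x - x)) := by
      rw [smul_sub, sub_eq_sub_iff_add_eq_add]
      simpa [add_comm] using hxy
    have h2 := hr.norm_sub_le hy hx
    have h3 : ‖x - y‖ = t * ‖(r y - y) - (r x - x)‖ := by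
      conv_lhs => rw [h1]
      rw [norm_smul, Real.norm_of_nonneg ht0]
    rw [norm_sub_rev y x] at h2
    have h4 : ‖x - y‖ ≤ t * K * ‖x - y‖ := by
      rw [mul_assoc]
      exact h3.le.trans (mul_le_mul_of_nonneg_left h2 ht0)
    rw [← sub_eq_zero, ← norm_eq_zero]
    nlinarith [norm_nonneg (x - y)]
  · rintro _ ⟨x, hx, rfl⟩
    have := convex_closedBall (0 : E) 1 hx (hmaps x hx) (sub_nonneg.2 ht1) ht0
      (sub_add_cancel 1 t)
    convert this using 1
    simp only [smul_sub, sub_smul, one_smul]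
    abel
  · have hG := lipschitzWith_indicator_closedBall hr fun x hx => by rw [h0 x hx, sub_self]
    set G := (closedBall (0 : E) 1).indicator fun x => r x - x with hGdef
    have hlip : ContractingWith (t.toNNReal * K) fun x => y - t • G x := by
      refine ⟨by
        rw [← NNReal.coe_lt_coe, NNReal.coe_mul, Real.coe_toNNReal t ht0]; exact htK, LipschitzWith.of_dist_le_mul fun a b => ?_⟩
      rw [dist_eq_norm, dist_eq_norm, sub_sub_sub_cancel_left, ← smul_sub, norm_smul,
        Real.norm_of_nonneg ht0, norm_sub_rev]
      have := hG.norm_sub_le a b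
      rw [NNReal.coe_mul, Real.coe_toNNReal t ht0, mul_assoc]
      exact mul_le_mul_of_nonneg_left this ht0
    obtain ⟨x, hx, -⟩ := hlip.exists_fixedPoint y (edist_ne_top _ _)
    have hx' : y - t • G x = x := hx
    by_cases hxB : x ∈ closedBall (0 : E) 1
    · refine ⟨x, hxB, ?_⟩
      rw [hGdef, indicator_of_mem hxB] at hx'
      exact (sub_eq_iff_eq_add.1 hx').symm
    · rw [hGdef, indicator_of_notMem hxB, smul_zero, sub_zero] at hx'
      exact absurd (hx' ▸ hy) hxB

end Perturbation

/-! ### No retraction onto the sphere, and fixed points. -/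

variable {E : Type*} [NormedAddCommGroup E] [InnerProductSpace ℝ E] [FiniteDimensional ℝ E]

/-- There is no `C¹` retraction of the closed unit ball onto the unit sphere. -/
theorem no_contDiffOn_retraction_sphere {r : E → E} (hr : ContDiffOn ℝ 1 r (closedBall 0 1))
    (hnorm : ∀ x ∈ closedBall (0 : E) 1, ‖r x‖ = 1)
    (h0 : ∀ x ∈ sphere (0 : E) 1, r x = x) : False := by
  let : MeasurableSpace E := borel E
  have : BorelSpace E := ⟨rfl⟩
  let μ : Measure E := Measure.addHaar
  set B := closedBall (0 : E) 1 with hB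
  have hconv : Convex ℝ B := convex_closedBall 0 1
  have hcomp : IsCompact B := isCompact_closedBall 0 1
  have huniq : UniqueDiffOn ℝ B := uniqueDiffOn_convex hconv
    ⟨0, ball_subset_interior_closedBall (mem_ball_self one_pos)⟩
  have hrd : ∀ x ∈ B, HasFDerivWithinAt r (fderivWithin ℝ r B x) B x := fun x hx =>
    (hr.differentiableOn one_ne_zero x hx).hasFDerivWithinAt
  let M : E → E →L[ℝ] E := fun x => fderivWithin ℝ r B x - ContinuousLinearMap.id ℝ E
  have hMcont : ContinuousOn M B :=
    (hr.continuousOn_fderivWithin huniq le_rfl).sub continuousOn_const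
  have hM : ∀ x ∈ B, HasFDerivWithinAt (fun x => r x - x) (M x) B x := fun x hx =>
    (hrd x hx).sub (hasFDerivWithinAt_id x B)
  obtain ⟨K, hK⟩ := hcomp.exists_bound_of_continuousOn hMcont
  lift K to ℝ≥0 using (norm_nonneg _).trans (hK 0 (mem_closedBall_self zero_le_one))
  have hlip : LipschitzOnWith K (fun x => r x - x) B :=
    hconv.lipschitzOnWith_of_nnnorm_hasFDerivWithin_le hM hK
  have hdet : ∀ x ∈ B, LinearMap.det (1 + (M x : E →ₗ[ℝ] E)) = 0 := by
    intro x hx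
    have h1 : (1 + (M x : E →ₗ[ℝ] E)) = (fderivWithin ℝ r B x : E →ₗ[ℝ] E) := by
      ext h; simp [M]
    rw [h1]
    by_contra hne
    -- If r' were invertible at x, some direction h would have r'(x) h = r(x); the constant function
    -- ‖r‖² would then have derivative 2‖r x‖² = 2 along h.
    obtain ⟨h, hh⟩ := (LinearMap.equivOfDetNeZero _ hne).surjective (r x)
    have h2 : HasFDerivWithinAt (fun x => ‖r x‖ ^ 2)
        (2 • (innerSL ℝ (r x)).comp (fderivWithin ℝ r B x)) B x := (hrd x hx).norm_sq
    have h3 : HasFDerivWithinAt (fun x => ‖r x‖ ^ 2) (0 : E →L[ℝ] ℝ) B x :=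
      (hasFDerivWithinAt_const (1 : ℝ) x B).congr (fun y hy => by rw [hnorm y hy, one_pow])
        (by rw [hnorm x hx, one_pow])
    have h4 := congrArg (fun A : E →L[ℝ] ℝ => A h) ((huniq x hx).eq h2 h3)
    have h5 : fderivWithin ℝ r B x h = r x := hh
    simp [h5, hnorm x hx] at h4
  -- Pairwise distinct interpolation nodes, small enough that τ i ≤ 1 and τ i * K < 1.
  let τ : ℕ → ℝ := fun i => 1 / (((i : ℝ) + 1) * (K + 1))
  have hτ0 : ∀ i, 0 < τ i := fun i => by positivity
  have hden : ∀ i : ℕ, (K : ℝ) + 1 ≤ ((i : ℝ) + 1) * (K + 1) := fun i =>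
    le_mul_of_one_le_left (by positivity) (by linarith [Nat.cast_nonneg (α := ℝ) i])
  have hτK : ∀ i, τ i * K < 1 := fun i => by
    rw [one_div_mul_eq_div, div_lt_one (by positivity)]
    linarith [hden i]
  have hτ1 : ∀ i, τ i ≤ 1 := fun i => by
    rw [div_le_one (by positivity)]
    linarith [hden i, K.coe_nonneg]
  have hτinj : Function.Injective τ := by
    intro i j hij
    have h1 : ((i : ℝ) + 1) * (K + 1) = ((j : ℝ) + 1) * (K + 1) := by
      simpa [τ] using hij
    have h2 := mul_right_cancel₀ (by positivity) h1
    exact_mod_cast add_right_cancel h2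
  have hpos : ∀ i, ∀ x ∈ B, 0 < LinearMap.det (1 + τ i • (M x : E →ₗ[ℝ] E)) := by
    intro i x hx
    have := det_one_add_pos (τ i • M x) (by
      rw [norm_smul, Real.norm_of_nonneg (hτ0 i).le]
      exact (mul_le_mul_of_nonneg_left (hK x hx) (hτ0 i).le).trans_lt (hτK i))
    simpa using this
  have hcontdet : ∀ i, ContinuousOn (fun x => LinearMap.det (1 + τ i • (M x : E →ₗ[ℝ] E))) B := by
    intro i
    have h1 : ContinuousOn (fun x => (ContinuousLinearMap.id ℝ E + τ i • M x).det) B :=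
      ContinuousLinearMap.continuous_det.comp_continuousOn
        (continuousOn_const.add (hMcont.const_smul (τ i)))
    exact h1
  have hint : ∀ i, IntegrableOn (fun x => LinearMap.det (1 + τ i • (M x : E →ₗ[ℝ] E))) B μ :=
    fun i => (hcontdet i).integrableOn_compact hcomp
  have hvol : ∀ i, ∫ x in B, LinearMap.det (1 + τ i • (M x : E →ₗ[ℝ] E)) ∂μ = μ.real B := by
    intro i
    obtain ⟨hinj, himg⟩ := injOn_image_closedBall_of_lipschitz hlip h0
      (fun x hx => by rw [mem_closedBall_zero_iff, hnorm x hx]) (hτ0 i).le (hτ1 i) (hτK i)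
    have h1 := integral_image_eq_integral_abs_det_fderiv_smul μ
      (f := fun x => x + τ i • (r x - x))
      (f' := fun x => ContinuousLinearMap.id ℝ E + τ i • M x) hcomp.measurableSet
      (fun x hx => (hasFDerivWithinAt_id x B).add ((hM x hx).const_smul (τ i))) hinj
      (fun _ => (1 : ℝ))
    rw [himg] at h1
    simp only [smul_eq_mul, mul_one, integral_const, MeasurableSet.univ, measureReal_restrict_apply,
      univ_inter] at h1
    rw [h1]
    refine setIntegral_congr_fun hcomp.measurableSet fun x hx => ?_
    exact (abs_of_pos (hpos i x hx)).symm
  have hsum : ∑ i ∈ Finset.range (finrank ℝ E + 1),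
      (Lagrange.basis (Finset.range (finrank ℝ E + 1)) τ i).eval 1 = 1 := by
    rw [← eval_finsetSum, Lagrange.sum_basis hτinj.injOn (by simp), eval_one]
  have hzero : ∫ x in B, LinearMap.det (1 + (M x : E →ₗ[ℝ] E)) ∂μ = 0 := by
    rw [setIntegral_congr_fun hcomp.measurableSet hdet]; simp
  have hone : ∫ x in B, LinearMap.det (1 + (M x : E →ₗ[ℝ] E)) ∂μ = μ.real B := by
    simp_rw [fun x => det_one_add_eq_sum (M x : E →ₗ[ℝ] E) τ hτinj]
    rw [integral_finsetSum _ fun i _ => (hint i).mul_const _]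
    simp_rw [integral_mul_const, hvol, ← Finset.mul_sum]
    rw [hsum, mul_one]
  have hposB : 0 < μ.real B := by
    rw [Measure.real, ENNReal.toReal_pos_iff]
    exact ⟨measure_closedBall_pos μ 0 one_pos, hcomp.measure_lt_top⟩
  linarith

/-- Otherwise x - (1 - ‖x‖²) P x never vanishes on the ball. It is the identity on the sphere, so
normalizing it gives a C¹ retraction. The factor 1 - ‖x‖² allows P to be any C¹ map, not only a
self-map of the ball. -/
theorem exists_eq_one_sub_norm_sq_smul_of_contDiff {P : E → E} (hP : ContDiff ℝ 1 P) :
    ∃ x ∈ closedBall (0 : E) 1, x = (1 - ‖x‖ ^ 2) • P x := by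
  by_contra! hne
  have hF : ∀ x ∈ closedBall (0 : E) 1, x - (1 - ‖x‖ ^ 2) • P x ≠ 0 := fun x hx =>
    sub_ne_zero.2 (hne x hx)
  have hFc : ContDiff ℝ 1 fun x : E => x - (1 - ‖x‖ ^ 2) • P x :=
    contDiff_id.sub ((contDiff_const.sub (contDiff_norm_sq ℝ)).smul hP)
  refine no_contDiffOn_retraction_sphere (E := E)
    (r := fun x => ‖x - (1 - ‖x‖ ^ 2) • P x‖⁻¹ • (x - (1 - ‖x‖ ^ 2) • P x))
    ?_ (fun x hx => ?_) (fun x hx => ?_)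
  · exact ((hFc.contDiffOn.norm ℝ hF).inv fun x hx => norm_ne_zero_iff.2 (hF x hx)).smul
      hFc.contDiffOn
  · rw [norm_smul, norm_inv, norm_norm, inv_mul_cancel₀ (norm_ne_zero_iff.2 (hF x hx))]
  · rw [mem_sphere_zero_iff_norm] at hx
    simp [hx]

/-- If there were no solution, the residual would have a positive minimum δ on the ball. A C¹ map Q
closer than δ to P has a solution, whose residual for P is less than δ. -/
theorem exists_eq_one_sub_norm_sq_smul {P : E → E} (hP : Continuous P) :
    ∃ x ∈ closedBall (0 : E) 1, x = (1 - ‖x‖ ^ 2) • P x := by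
  have hcont : ContinuousOn (fun x => ‖x - (1 - ‖x‖ ^ 2) • P x‖) (closedBall 0 1) := by fun_prop
  obtain ⟨x₀, hx₀, hmin⟩ := (isCompact_closedBall (0 : E) 1).exists_isMinOn
    ⟨0, mem_closedBall_self zero_le_one⟩ hcont
  by_contra! hne
  have hδ : 0 < ‖x₀ - (1 - ‖x₀‖ ^ 2) • P x₀‖ := norm_pos_iff.2 (sub_ne_zero.2 (hne x₀ hx₀))
  obtain ⟨Q, hQ, hQP, -⟩ := hP.exists_contDiff_approx 1
    (ε := fun _ => ‖x₀ - (1 - ‖x₀‖ ^ 2) • P x₀‖) continuous_const fun _ => hδ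
  obtain ⟨x, hx, hxQ⟩ := exists_eq_one_sub_norm_sq_smul_of_contDiff hQ
  have h1 : ‖x - (1 - ‖x‖ ^ 2) • P x‖ = |1 - ‖x‖ ^ 2| * dist (Q x) (P x) := by
    conv_lhs => enter [1, 1]; rw [hxQ]
    rw [← smul_sub, norm_smul, dist_eq_norm, Real.norm_eq_abs]
  have h2 : |1 - ‖x‖ ^ 2| ≤ 1 := by
    rw [mem_closedBall_zero_iff] at hx
    rw [abs_le]
    constructor <;> nlinarith [norm_nonneg x]
  have h3 := hmin hx
  have h4 := hQP x
  simp only [mem_ofPred_eq, h1] at h3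
  nlinarith [mul_le_of_le_one_left (dist_nonneg (x := Q x) (y := P x)) h2]

/-- A bounded continuous self-map of a Euclidean space has a fixed point. -/
theorem exists_fixedPoint_of_continuous_of_bounded {f : E → E} (hf : Continuous f) {M : ℝ}
    (hM : ∀ x, ‖f x‖ ≤ M) : ∃ x, f x = x := by
  have hM0 : 0 ≤ M := (norm_nonneg _).trans (hM 0)
  -- The scaling makes ‖c⁻¹ f‖ ≤ 1/2.
  let c : ℝ := 2 * M + 1
  have hc : 0 < c := by positivity
  -- Dividing by κ cancels the factor 1 - ‖u‖² when ‖u‖ ≤ 1/2, since 3/4 = 1 - (1/2)², and avoids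
  -- division by zero at the sphere. The solution u turns out to lie in that region.
  let κ : E → ℝ := fun u => max (1 - ‖u‖ ^ 2) (3 / 4)
  have hκ : ∀ u, 0 < κ u := fun u => lt_max_of_lt_right (by norm_num)
  have hκc : Continuous κ := by fun_prop
  obtain ⟨u, hu, hueq⟩ := exists_eq_one_sub_norm_sq_smul
    (P := fun u => (κ u)⁻¹ • c⁻¹ • f (c • u))
    ((hκc.inv₀ fun u => (hκ u).ne').smul ((hf.comp (continuous_const_smul c)).const_smul c⁻¹))
  rw [mem_closedBall_zero_iff] at hu
  have hχ : 0 ≤ 1 - ‖u‖ ^ 2 := by nlinarith [norm_nonneg u]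
  have hnorm : ‖u‖ ≤ 1 / 2 := by
    rw [hueq, norm_smul, norm_smul, norm_smul, Real.norm_of_nonneg hχ, norm_inv, norm_inv,
      Real.norm_of_nonneg (hκ u).le, Real.norm_of_nonneg hc.le, ← mul_assoc]
    have h1 : (1 - ‖u‖ ^ 2) * (κ u)⁻¹ ≤ 1 := by
      rw [← div_eq_mul_inv, div_le_one (hκ u)]
      exact le_max_left _ _
    have h2 : c⁻¹ * ‖f (c • u)‖ ≤ 1 / 2 := by
      rw [inv_mul_le_iff₀ hc]
      have := hM (c • u)
      simp only [c] at this ⊢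
      linarith
    exact (mul_le_of_le_one_left (by positivity) h1).trans h2
  have hκu : κ u = 1 - ‖u‖ ^ 2 := max_eq_left (by nlinarith [norm_nonneg u])
  refine ⟨c • u, ?_⟩
  have hne : 1 - ‖u‖ ^ 2 ≠ 0 := hκu ▸ (hκ u).ne'
  rw [hκu, smul_inv_smul₀ hne] at hueq
  conv_rhs => rw [hueq]
  rw [smul_inv_smul₀ hc.ne']

/-- **Brouwer's fixed point theorem** for boxes. -/
theorem exists_fixedPoint_of_mapsTo_Icc {ι : Type*} [Fintype ι] {a b : ι → ℝ} (hab : a ≤ b)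
    {f : (ι → ℝ) → ι → ℝ} (hf : ContinuousOn f (Icc a b)) (hmaps : MapsTo f (Icc a b) (Icc a b)) :
    ∃ x ∈ Icc a b, f x = x := by
  let e := EuclideanSpace.equiv ι ℝ
  let pr : (ι → ℝ) → ι → ℝ := fun x i => max (a i) (min (b i) (x i))
  have hprc : Continuous pr := by fun_prop
  have hpr : ∀ x, pr x ∈ Icc a b := fun x =>
    ⟨fun i => le_max_left _ _, fun i => max_le (hab i) (min_le_left _ _)⟩
  have hpr' : ∀ x ∈ Icc a b, pr x = x := fun x hx => by
    ext i
    simp [pr, min_eq_right (hx.2 i), max_eq_right (hx.1 i)]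
  have hc : Continuous fun x => e.symm (f (pr (e x))) :=
    e.symm.continuous.comp (hf.comp_continuous (hprc.comp e.continuous) fun x => hpr _)
  obtain ⟨M, hM⟩ := (isCompact_Icc (a := a) (b := b)).exists_bound_of_continuousOn
    (f := fun x => e.symm x) e.symm.continuous.continuousOn
  obtain ⟨x, hx⟩ := exists_fixedPoint_of_continuous_of_bounded hc
    (M := M) fun x => hM _ (hmaps (hpr _))
  have hx' : f (pr (e x)) = e x := (e.symm_apply_eq.1 hx)
  have hmem : e x ∈ Icc a b := hx' ▸ hmaps (hpr _)
  exact ⟨e x, hmem, by rw [hpr' _ hmem] at hx'; exact hx'⟩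

end Brouwer

namespace ExclusionRegions

/-! ### Componentwise estimates and propagation of bounds along the curve g. -/

section Bounds

variable {ι κ τ τ' : Type*}

theorem abs_mulVec_le [Fintype κ] {M N : Matrix ι κ ℝ} {x y : κ → ℝ} {i : ι}
    (hM : ∀ k, |M i k| ≤ N i k) (hx : ∀ k, |x k| ≤ y k) : |M.mulVec x i| ≤ N.mulVec y i := by
  refine (Finset.abs_sum_le_sum_abs _ _).trans (Finset.sum_le_sum fun k _ => ?_)
  rw [abs_mul]
  exact mul_le_mul (hM k) (hx k) (abs_nonneg _) ((abs_nonneg _).trans (hM k))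

theorem abs_tensorMulVec_le [Fintype τ] {T U : Tensor ι κ τ} {x y : τ → ℝ} {i : ι} {j : κ}
    (hT : ∀ k, |T i j k| ≤ U i j k) (hx : ∀ k, |x k| ≤ y k) :
    |tensorMulVec T x i j| ≤ tensorMulVec U y i j := by
  refine (Finset.abs_sum_le_sum_abs _ _).trans (Finset.sum_le_sum fun k _ => ?_)
  rw [abs_mul]
  exact mul_le_mul (hT k) (hx k) (abs_nonneg _) ((abs_nonneg _).trans (hT k))

theorem abs_tensorQuad_le [Fintype κ] {T U : Tensor ι κ κ} {x y : κ → ℝ} {i : ι}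
    (hT : ∀ j k, |T i j k| ≤ U i j k) (hx : ∀ k, |x k| ≤ y k) :
    |tensorQuad x T i| ≤ tensorQuad y U i :=
  abs_mulVec_le (fun j => abs_tensorMulVec_le (hT j) hx) hx

theorem mulVec_le_mulVec [Fintype κ] {M N : Matrix ι κ ℝ} {x y : κ → ℝ} {i : ι}
    (hM : ∀ k, M i k ≤ N i k) (hN : ∀ k, 0 ≤ N i k) (hx0 : ∀ k, 0 ≤ x k)
    (hx : ∀ k, x k ≤ y k) : M.mulVec x i ≤ N.mulVec y i :=
  Finset.sum_le_sum fun k _ => mul_le_mul (hM k) (hx k) (hx0 k) (hN k)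

theorem tensorMulVec_le_tensorMulVec [Fintype τ] {T U : Tensor ι κ τ} {x y : τ → ℝ} {i : ι}
    {j : κ} (hT : ∀ k, T i j k ≤ U i j k) (hU : ∀ k, 0 ≤ U i j k) (hx0 : ∀ k, 0 ≤ x k)
    (hx : ∀ k, x k ≤ y k) : tensorMulVec T x i j ≤ tensorMulVec U y i j :=
  Finset.sum_le_sum fun k _ => mul_le_mul (hT k) (hx k) (hx0 k) (hU k)

theorem mulVec_nonneg [Fintype κ] {M : Matrix ι κ ℝ} {x : κ → ℝ} {i : ι} (hM : ∀ k, 0 ≤ M i k)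
    (hx : ∀ k, 0 ≤ x k) : 0 ≤ M.mulVec x i := by
  rw [Matrix.mulVec, dotProduct]
  exact Finset.sum_nonneg fun k _ => mul_nonneg (hM k) (hx k)

theorem tensorMulVec_nonneg [Fintype τ] {T : Tensor ι κ τ} {x : τ → ℝ} {i : ι} {j : κ}
    (hT : ∀ k, 0 ≤ T i j k) (hx : ∀ k, 0 ≤ x k) : 0 ≤ tensorMulVec T x i j := by
  rw [tensorMulVec, Matrix.of_apply]
  exact Finset.sum_nonneg fun k _ => mul_nonneg (hT k) (hx k)

theorem mul_tensorMulVec [Fintype ι] [Fintype τ] (C : Matrix ι ι ℝ) (T : Tensor ι κ τ)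
    (x : τ → ℝ) : C * tensorMulVec T x = tensorMulVec (matMulTensor C T) x := by
  ext i j
  simp only [Matrix.mul_apply, tensorMulVec, Matrix.of_apply, matMulTensor, Finset.mul_sum,
    Finset.sum_mul]
  rw [Finset.sum_comm]
  exact Finset.sum_congr rfl fun _ _ => Finset.sum_congr rfl fun _ _ => (mul_assoc _ _ _).symm

theorem tensorMulVec_tensorMulMat [Fintype τ] [Fintype τ'] (T : Tensor ι κ τ) (B : Matrix τ τ' ℝ)
    (x : τ' → ℝ) : tensorMulVec (tensorMulMat T B) x = tensorMulVec T (B.mulVec x) := by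
  ext i j
  simp only [tensorMulVec, Matrix.of_apply, tensorMulMat, Matrix.mulVec, dotProduct,
    Finset.mul_sum, Finset.sum_mul]
  rw [Finset.sum_comm]
  exact Finset.sum_congr rfl fun _ _ => Finset.sum_congr rfl fun _ _ => mul_assoc _ _ _

theorem tensorQuad_smul [Fintype κ] (r : ℝ) (v : κ → ℝ) (T : Tensor ι κ κ) (i : ι) :
    tensorQuad (r • v) T i = r ^ 2 * tensorQuad v T i := by
  simp only [tensorQuad, tensorMulVec_smul, Matrix.mulVec_smul, Matrix.smul_mulVec,
    Pi.smul_apply, smul_eq_mul]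
  ring

variable {n m : ℕ}

theorem wVec_apply (v : Fin n → ℝ) (B₀ : Matrix (Fin n) (Fin n) ℝ) (j : Fin n) :
    wVec v B₀ j = v j - B₀.mulVec v j := by
  simp [wVec, Matrix.sub_mulVec]

theorem curve_sub_curve {xhat : (Fin m → ℝ) → Fin n → ℝ} {p s : Fin m → ℝ}
    {N : Matrix (Fin n) (Fin m) ℝ} (hN : IsSlope xhat p s N) :
    curve xhat s - curve xhat p = (curveSlope N).mulVec (s - p) := by
  have h : xhat s - xhat p = N.mulVec (s - p) := hN
  rw [curveSlope, Matrix.fromRows_mulVec, ← h, Matrix.one_mulVec]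
  ext (i | i) <;> simp [curve]

theorem abs_curve_sub_curve_le {xhat : (Fin m → ℝ) → Fin n → ℝ} {p s : Fin m → ℝ}
    {N : Matrix (Fin n) (Fin m) ℝ} (hN : IsSlope xhat p s N) (k : Fin n ⊕ Fin m) :
    |(curve xhat s - curve xhat p) k| ≤ (absMat (curveSlope N)).mulVec (absVec (s - p)) k := by
  rw [curve_sub_curve hN]
  exact abs_mulVec_le (fun _ => le_rfl) fun _ => le_rfl

theorem slopeG₀_nonneg (M : Matrix (Fin n) (Fin n ⊕ Fin m) ℝ) (N : Matrix (Fin n) (Fin m) ℝ)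
    (i : Fin n) (k : Fin m) : 0 ≤ slopeG₀ M N i k := by
  rw [slopeG₀, Matrix.mul_apply]
  exact Finset.sum_nonneg fun _ _ => mul_nonneg (abs_nonneg _) (abs_nonneg _)

theorem slopeA_nonneg (C : Matrix (Fin n) (Fin n) ℝ) (T : Tensor (Fin n) (Fin n) (Fin n ⊕ Fin m))
    (N : Matrix (Fin n) (Fin m) ℝ) (i j : Fin n) (k : Fin m) : 0 ≤ slopeA C T N i j k := by
  rw [slopeA, tensorMulMat]
  exact Finset.sum_nonneg fun _ _ => mul_nonneg (abs_nonneg _) (abs_nonneg _)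

theorem abs_apply_curve_le_bAt {F : (Fin n ⊕ Fin m → ℝ) → Fin n → ℝ}
    {xhat : (Fin m → ℝ) → Fin n → ℝ} {p s : Fin m → ℝ} {N : Matrix (Fin n) (Fin m) ℝ}
    {M : Matrix (Fin n) (Fin n ⊕ Fin m) ℝ} {b : Fin n → ℝ} (hN : IsSlope xhat p s N)
    (hM : IsSlope F (curve xhat p) (curve xhat s) M) (hb : ∀ i, |F (curve xhat p) i| ≤ b i)
    (i : Fin n) : |F (curve xhat s) i| ≤ bAt b (slopeG₀ M N) (absVec (s - p)) i := by
  have h : F (curve xhat s) = F (curve xhat p) + M.mulVec (curve xhat s - curve xhat p) :=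
    sub_eq_iff_eq_add'.1 hM
  rw [h, bAt, slopeG₀, ← Matrix.mulVec_mulVec]
  exact (abs_add_le _ _).trans (add_le_add (hb i)
    (abs_mulVec_le (fun _ => le_rfl) (abs_curve_sub_curve_le hN)))

theorem abs_mul_sub_one_le_B₀At {J : (Fin n ⊕ Fin m → ℝ) → Matrix (Fin n) (Fin n) ℝ}
    {xhat : (Fin m → ℝ) → Fin n → ℝ} {p s : Fin m → ℝ} {N : Matrix (Fin n) (Fin m) ℝ}
    {T : Tensor (Fin n) (Fin n) (Fin n ⊕ Fin m)} {C B₀ : Matrix (Fin n) (Fin n) ℝ}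
    (hN : IsSlope xhat p s N) (hT : IsMatrixSlope J (curve xhat p) (curve xhat s) T)
    (hB₀ : ∀ i j, |(C * J (curve xhat p) - 1) i j| ≤ B₀ i j) (i j : Fin n) :
    |(C * J (curve xhat s) - 1) i j| ≤ B₀At B₀ (slopeA C T N) (absVec (s - p)) i j := by
  have h : J (curve xhat s) = J (curve xhat p) + tensorMulVec T (curve xhat s - curve xhat p) :=
    sub_eq_iff_eq_add'.1 hT
  have h' : C * J (curve xhat s) - 1 = (C * J (curve xhat p) - 1) +
      tensorMulVec (matMulTensor C T) (curve xhat s - curve xhat p) := by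
    rw [h, mul_add, mul_tensorMulVec]; abel
  rw [h', B₀At, slopeA, tensorMulVec_tensorMulMat]
  exact (abs_add_le _ _).trans (add_le_add (hB₀ i j)
    (abs_tensorMulVec_le (fun _ => le_rfl) (abs_curve_sub_curve_le hN)))

end Bounds

/-! ### The quadratic majorant: its roots and their monotonicity. -/

section Parameters

variable {n : ℕ} {v b b' : Fin n → ℝ} {B₀ B₀' : Matrix (Fin n) (Fin n) ℝ}
  {B B' : Tensor (Fin n) (Fin n) (Fin n)} {j : Fin n}

theorem aVec_mul_lamEj (ha : 0 < aVec v B j) :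
    aVec v B j * lamEj v b B₀ B j = (wVec v B₀ j + √(disc v b B₀ B j)) / 2 := by
  rw [lamEj]; field_simp

/-- λᵉ_j is the larger root by the quadratic formula; by Vieta, b_j / (a_j λᵉ_j) is the smaller one.
-/
theorem quadratic_eq_mul (ha : 0 < aVec v B j) (hw : 0 < wVec v B₀ j)
    (hD : 0 ≤ disc v b B₀ B j) (t : ℝ) :
    aVec v B j * t ^ 2 - wVec v B₀ j * t + b j =
      aVec v B j * ((t - lamIj v b B₀ B j) * (t - lamEj v b B₀ B j)) := by
  have hS := Real.sq_sqrt hD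
  have hS0 := Real.sqrt_nonneg (disc v b B₀ B j)
  have hne : wVec v B₀ j + √(disc v b B₀ B j) ≠ 0 := by positivity
  have hI : lamIj v b B₀ B j = (wVec v B₀ j - √(disc v b B₀ B j)) / (2 * aVec v B j) := by
    rw [lamIj, aVec_mul_lamEj ha, div_eq_div_iff (by positivity) (by positivity)]
    rw [disc] at hS ⊢
    nlinarith
  rw [hI, lamEj]
  field_simp
  rw [disc] at hS ⊢
  nlinarith

theorem disc_anti (ha : 0 ≤ aVec v B j) (haa : aVec v B j ≤ aVec v B' j)
    (hw0 : 0 ≤ wVec v B₀' j) (hw : wVec v B₀' j ≤ wVec v B₀ j) (hb0 : 0 ≤ b j)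
    (hb : b j ≤ b' j) : disc v b' B₀' B' j ≤ disc v b B₀ B j := by
  have h1 := pow_le_pow_left₀ hw0 hw 2
  have h2 := mul_le_mul haa hb hb0 (ha.trans haa)
  simp only [disc]
  linarith

theorem lamEj_anti (ha : 0 < aVec v B j) (haa : aVec v B j ≤ aVec v B' j)
    (hw0 : 0 ≤ wVec v B₀' j) (hw : wVec v B₀' j ≤ wVec v B₀ j) (hb0 : 0 ≤ b j)
    (hb : b j ≤ b' j) : lamEj v b' B₀' B' j ≤ lamEj v b B₀ B j := by
  have hD := Real.sqrt_le_sqrt (disc_anti ha.le haa hw0 hw hb0 hb)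
  have hw1 := hw0.trans hw
  rw [lamEj, lamEj]
  exact div_le_div₀ (by positivity) (add_le_add hw hD) (by positivity) (by linarith)

/-- In the form 2 b / (w + √D), worse bounds raise the numerator and lower the denominator. -/
theorem lamIj_mono (ha : 0 < aVec v B j) (haa : aVec v B j ≤ aVec v B' j)
    (hw0 : 0 ≤ wVec v B₀' j) (hw : wVec v B₀' j ≤ wVec v B₀ j) (hb0 : 0 ≤ b j)
    (hb : b j ≤ b' j) (hD' : 0 ≤ disc v b' B₀' B' j) :
    lamIj v b B₀ B j ≤ lamIj v b' B₀' B' j := by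
  have hD := Real.sqrt_le_sqrt (disc_anti ha.le haa hw0 hw hb0 hb)
  have hw1 := hw0.trans hw
  have ha' := ha.trans_le haa
  rw [lamIj, lamIj, aVec_mul_lamEj ha, aVec_mul_lamEj ha']
  have hS' := Real.sqrt_nonneg (disc v b' B₀' B' j)
  rcases (add_nonneg hw0 hS').eq_or_lt with h | h
  -- With a zero denominator the quotient on the right is 0 by convention; here b' = 0, hence b = 0
  -- and both sides vanish.
  · have hw' : wVec v B₀' j = 0 := by linarith
    have hd : disc v b' B₀' B' j = 0 := (Real.sqrt_eq_zero hD').1 (by linarith)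
    rw [disc, hw'] at hd
    have hb' : b' j = 0 := by
      rcases mul_eq_zero.1 (show aVec v B' j * b' j = 0 by linarith) with h0 | h0
      · exact absurd h0 ha'.ne'
      · exact h0
    rw [hb', le_antisymm (hb'.symm ▸ hb) hb0, zero_div, zero_div]
  · exact div_le_div₀ (hb0.trans hb) hb (by positivity) (by linarith)

theorem lamI_mono [NeZero n] (h : ∀ j, lamIj v b B₀ B j ≤ lamIj v b' B₀' B' j) :
    lamI v b B₀ B ≤ lamI v b' B₀' B' :=
  ciSup_mono (Set.finite_range _).bddAbove h

theorem lamE_mono [NeZero n] (h : ∀ j, lamEj v b B₀ B j ≤ lamEj v b' B₀' B' j) :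
    lamE v b B₀ B ≤ lamE v b' B₀' B' :=
  ciInf_mono (Set.finite_range _).bddBelow h

/-- The line `w - α r` is positive, and so is the discriminant, below the smaller root. -/
theorem le_muLower {α w a G b r : ℝ} (hα : 0 < α) (hw : 0 < w) (ha : 0 < a) (hG : 0 ≤ G)
    (hb : 0 ≤ b) (hr : r ≤ muLower α (α * w + 2 * a * G) (w ^ 2 - 4 * a * b)) :
    0 ≤ w - r * α ∧
      0 ≤ α ^ 2 * r ^ 2 - 2 * (α * w + 2 * a * G) * r + (w ^ 2 - 4 * a * b) ∧
      (r < muLower α (α * w + 2 * a * G) (w ^ 2 - 4 * a * b) → 0 < w - r * α ∧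
        0 < α ^ 2 * r ^ 2 - 2 * (α * w + 2 * a * G) * r + (w ^ 2 - 4 * a * b)) := by
  set β := α * w + 2 * a * G with hβ
  set γ := w ^ 2 - 4 * a * b with hγ
  have hβ0 : 0 < β := by positivity
  have hrad : 0 ≤ β ^ 2 - α ^ 2 * γ := by
    have : β ^ 2 - α ^ 2 * γ = 4 * α * w * a * G + 4 * a ^ 2 * G ^ 2 + 4 * α ^ 2 * a * b := by
      rw [hβ, hγ]; ring
    rw [this]; positivity
  have hS := Real.sq_sqrt hrad
  have hS0 := Real.sqrt_nonneg (β ^ 2 - α ^ 2 * γ)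
  set R := √(β ^ 2 - α ^ 2 * γ) with hR
  have hU : muUpper α β γ = (β + R) / α ^ 2 := rfl
  have hL : muLower α β γ = (β - R) / α ^ 2 := by
    rw [muLower, hU, div_eq_div_iff (by positivity) (by positivity)]
    field_simp
    nlinarith
  have hLU : muLower α β γ ≤ muUpper α β γ := by
    rw [hL, hU]; gcongr; linarith
  have hfac : ∀ t, α ^ 2 * t ^ 2 - 2 * β * t + γ =
      α ^ 2 * ((muLower α β γ - t) * (muUpper α β γ - t)) := by
    intro t
    rw [hL, hU]
    field_simp
    nlinarith
  -- At t = w / α the linear form w - α t vanishes and the quadratic equals -4a(b + tG) ≤ 0, so w /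
  -- α cannot lie below the smaller root.
  have hwα : muLower α β γ * α ≤ w := by
    by_contra! hlt
    have h1 : w / α < muLower α β γ := (div_lt_iff₀ hα).2 hlt
    have h2 : 0 < α ^ 2 * ((muLower α β γ - w / α) * (muUpper α β γ - w / α)) :=
      mul_pos (by positivity) (mul_pos (by linarith) (by linarith))
    rw [← hfac] at h2
    have h3 : α ^ 2 * (w / α) ^ 2 - 2 * β * (w / α) + γ = -(4 * a * (b + w / α * G)) := by
      rw [hβ, hγ]; field_simp; ring
    rw [h3] at h2
    have : 0 ≤ 4 * a * (b + w / α * G) := by positivity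
    linarith
  refine ⟨by nlinarith, ?_, fun h => ⟨by nlinarith, ?_⟩⟩
  · rw [hfac]
    exact mul_nonneg (by positivity) (mul_nonneg (by linarith) (by linarith))
  · rw [hfac]
    exact mul_pos (by positivity) (mul_pos (by linarith) (by linarith))

end Parameters

/-! ### Existence and exclusion at a fixed parameter. -/

section Exclusion

variable {n : ℕ}

theorem mem_box_iff {c v x : Fin n → ℝ} {r : ℝ} :
    x ∈ box c v r ↔ ∀ j, |x j - c j| ≤ r * v j := by
  simp only [box, Set.mem_Icc, Pi.le_def, ← forall_and, Pi.sub_apply, Pi.add_apply,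
    Pi.smul_apply, smul_eq_mul, abs_le]
  refine forall_congr' fun j => ?_
  constructor <;> rintro ⟨h1, h2⟩ <;> constructor <;> linarith

/-- The scaled maximum norm of `d` is attained. -/
theorem exists_abs_le_mul [NeZero n] {v : Fin n → ℝ} (hv : ∀ j, 0 < v j) (d : Fin n → ℝ) :
    ∃ r, 0 ≤ r ∧ (∀ k, |d k| ≤ r * v k) ∧ ∃ j, |d j| = r * v j := by
  obtain ⟨j, hj⟩ := Finite.exists_max fun k => |d k| / v k
  exact ⟨|d j| / v j, div_nonneg (abs_nonneg _) (hv j).le,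
    fun k => (div_le_iff₀ (hv k)).1 (hj k), j, (div_mul_cancel₀ _ (hv j).ne').symm⟩

/-- B₀ v < v means that N - 1 is a strict contraction in the maximum norm scaled by v, so N has
trivial kernel. -/
theorem det_ne_zero_of_wVec_pos {v : Fin n → ℝ} (hv : ∀ j, 0 < v j)
    {N B₀ : Matrix (Fin n) (Fin n) ℝ} (hN : ∀ i j, |(N - 1) i j| ≤ B₀ i j)
    (hw : ∀ j, 0 < wVec v B₀ j) : N.det ≠ 0 := by
  intro h
  obtain ⟨x, hx0, hx⟩ := Matrix.exists_mulVec_eq_zero_iff.2 h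
  have : NeZero n := ⟨by rintro rfl; exact hx0 (Subsingleton.elim _ _)⟩
  obtain ⟨r, hr, hle, j, hj⟩ := exists_abs_le_mul hv x
  have h1 := abs_mulVec_le (i := j) (hN j) (y := r • v) hle
  rw [Matrix.sub_mulVec, hx, Matrix.one_mulVec, zero_sub, Pi.neg_apply, abs_neg, hj,
    Matrix.mulVec_smul, Pi.smul_apply, smul_eq_mul] at h1
  have h2 := hw j
  rw [wVec_apply] at h2
  have hr0 : r = 0 := by
    by_contra hne
    have hpos : 0 < r := lt_of_le_of_ne hr (Ne.symm hne)
    nlinarith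
  refine hx0 (funext fun k => ?_)
  have := hle k
  rw [hr0, zero_mul] at this
  exact abs_nonpos_iff.1 this

variable {F : (Fin n → ℝ) → Fin n → ℝ} {C J B₀ : Matrix (Fin n) (Fin n) ℝ}
  {b v c x : Fin n → ℝ} {T B : Tensor (Fin n) (Fin n) (Fin n)}

/-- The deviation of the preconditioned function from the identity, on a box of radius `r`. -/
theorem abs_sub_mulVec_le (hb : ∀ i, |C.mulVec (F c) i| ≤ b i)
    (hB₀ : ∀ i j, |(C * J - 1) i j| ≤ B₀ i j) (hT : IsSecondSlope F J c x T)
    (hB : ∀ i j k, |matMulTensor C T i j k| ≤ B i j k) {r : ℝ}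
    (hx : ∀ k, |x k - c k| ≤ r * v k) (j : Fin n) :
    |x j - c j - C.mulVec (F x) j| ≤ r * v j + (aVec v B j * r ^ 2 - wVec v B₀ j * r + b j) := by
  have h : F x = F c + (J + tensorMulVec T (x - c)).mulVec (x - c) := sub_eq_iff_eq_add'.1 hT
  have h1 : C.mulVec (F x) = C.mulVec (F c) + (C * J - 1).mulVec (x - c) + (x - c) +
      tensorQuad (x - c) (matMulTensor C T) := by
    rw [h, Matrix.mulVec_add, Matrix.mulVec_mulVec, mul_add, mul_tensorMulVec, Matrix.add_mulVec,
      Matrix.sub_mulVec, Matrix.one_mulVec, tensorQuad]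
    abel
  have h2 : x j - c j - C.mulVec (F x) j = -(C.mulVec (F c) j + (C * J - 1).mulVec (x - c) j +
      tensorQuad (x - c) (matMulTensor C T) j) := by
    rw [h1]; simp only [Pi.add_apply, Pi.sub_apply]; ring
  have h3 := abs_mulVec_le (i := j) (hB₀ j) (x := x - c) (y := r • v) hx
  have h4 := abs_tensorQuad_le (i := j) (hB j) (x := x - c) (y := r • v) hx
  rw [Matrix.mulVec_smul, Pi.smul_apply, smul_eq_mul] at h3
  rw [tensorQuad_smul] at h4
  rw [h2, abs_neg, wVec_apply, aVec]
  refine (abs_add_three _ _ _).trans ?_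
  linarith [hb j]

/-- The inclusion and exclusion regions at a fixed parameter. -/
theorem exists_zero_and_ne_zero [NeZero n] {x₁ x₂ : Fin n → ℝ}
    {T : (Fin n → ℝ) → Tensor (Fin n) (Fin n) (Fin n)} (hv : ∀ j, 0 < v j)
    (hF : ContinuousOn F (Set.Icc x₁ x₂)) (hb : ∀ i, |C.mulVec (F c) i| ≤ b i)
    (hB₀ : ∀ i j, |(C * J - 1) i j| ≤ B₀ i j)
    (hT : ∀ x ∈ Set.Icc x₁ x₂, IsSecondSlope F J c x (T x))
    (hB : ∀ x ∈ Set.Icc x₁ x₂, ∀ i j k, |matMulTensor C (T x) i j k| ≤ B i j k)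
    (hw : ∀ j, 0 < wVec v B₀ j) (ha : ∀ j, 0 < aVec v B j) (hD : ∀ j, 0 < disc v b B₀ B j)
    (hlt : lamI v b B₀ B < lamE v b B₀ B)
    (hsub : box c v (lamI v b B₀ B) ⊆ Set.Icc x₁ x₂) :
    (∃ x ∈ box c v (lamI v b B₀ B), F x = 0) ∧
      ∀ x ∈ interior (box c v (lamE v b B₀ B) ∩ Set.Icc x₁ x₂) \ box c v (lamI v b B₀ B),
        F x ≠ 0 := by
  have hIj : ∀ j, lamIj v b B₀ B j ≤ lamI v b B₀ B := fun j =>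
    le_ciSup (Set.finite_range _).bddAbove j
  have hEj : ∀ j, lamE v b B₀ B ≤ lamEj v b B₀ B j := fun j =>
    ciInf_le (Set.finite_range _).bddBelow j
  have hb0 : ∀ j, 0 ≤ b j := fun j => (abs_nonneg _).trans (hb j)
  have hI0 : 0 ≤ lamI v b B₀ B := by
    refine le_trans ?_ (hIj 0)
    rw [lamIj, aVec_mul_lamEj (ha 0)]
    have := hw 0
    have := hb0 0
    positivity
  have hC : C.det ≠ 0 := by
    have := det_ne_zero_of_wVec_pos hv hB₀ hw
    rw [Matrix.det_mul] at this
    exact left_ne_zero_of_mul this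
  constructor
  · have hle : c - lamI v b B₀ B • v ≤ c + lamI v b B₀ B • v := fun j => by
      have := mul_nonneg hI0 (hv j).le
      simp only [Pi.sub_apply, Pi.add_apply, Pi.smul_apply, smul_eq_mul]
      linarith
    obtain ⟨x, hx, hfix⟩ := exists_fixedPoint_of_mapsTo_Icc hle
      (f := fun x => x - C.mulVec (F x))
      (continuousOn_id.sub ((Continuous.matrix_mulVec continuous_const
        continuous_id).comp_continuousOn (hF.mono hsub)))
      (fun x hx => mem_box_iff.2 fun j => by
        have h1 := abs_sub_mulVec_le hb hB₀ (hT x (hsub hx)) (hB x (hsub hx)) (mem_box_iff.1 hx) j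
        rw [quadratic_eq_mul (ha j) (hw j) (hD j).le] at h1
        have h2 : (lamI v b B₀ B - lamIj v b B₀ B j) * (lamI v b B₀ B - lamEj v b B₀ B j) ≤ 0 :=
          mul_nonpos_of_nonneg_of_nonpos (by linarith [hIj j]) (by linarith [hEj j])
        have h3 := mul_nonpos_of_nonneg_of_nonpos (ha j).le h2
        have h4 : (x - C.mulVec (F x)) j - c j = x j - c j - C.mulVec (F x) j := by
          rw [Pi.sub_apply]; ring
        rw [h4]
        linarith)
    refine ⟨x, hx, ?_⟩
    exact Matrix.eq_zero_of_mulVec_eq_zero hC (sub_eq_self.1 hfix)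
  · rintro x ⟨hx, hxI⟩ h0
    have hxX : x ∈ Set.Icc x₁ x₂ := (interior_subset hx).2
    have hxE : ∀ j, |x j - c j| < lamE v b B₀ B * v j := by
      have hx' := interior_mono Set.inter_subset_left hx
      rw [box, ← Set.pi_univ_Icc, interior_pi_set Set.finite_univ] at hx'
      intro j
      have := hx' j (Set.mem_univ j)
      simp only [interior_Icc, Pi.sub_apply, Pi.add_apply, Pi.smul_apply, smul_eq_mul, Set.mem_Ioo] at this
      rw [abs_lt]
      constructor <;> linarith
    -- The radius r is the scaled distance of x from c; at the coordinate j attaining it the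
    -- estimate has r v_j on both sides, leaving 0 ≤ q_j(r).
    obtain ⟨r, hr, hle, j, hj⟩ := exists_abs_le_mul hv (x - c)
    have hrE : r < lamE v b B₀ B := by
      have := hxE j
      rw [← Pi.sub_apply, hj] at this
      exact lt_of_mul_lt_mul_right this (hv j).le
    have hrI : lamI v b B₀ B < r := by
      by_contra! hcon
      exact hxI (mem_box_iff.2 fun k => (hle k).trans
        (mul_le_mul_of_nonneg_right hcon (hv k).le))
    have h1 := abs_sub_mulVec_le hb hB₀ (hT x hxX) (hB x hxX) hle j
    rw [h0, Matrix.mulVec_zero, Pi.zero_apply, sub_zero, ← Pi.sub_apply, hj,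
      quadratic_eq_mul (ha j) (hw j) (hD j).le] at h1
    have h2 : (r - lamIj v b B₀ B j) * (r - lamEj v b B₀ B j) < 0 :=
      mul_neg_of_pos_of_neg (by linarith [hIj j]) (by linarith [hEj j])
    have h3 := mul_neg_of_pos_of_neg (ha j) h2
    linarith

end Exclusion

end ExclusionRegions

/-- A point in the interior of the box of radius `μ` lies in a box of smaller radius. -/
theorem ExclusionRegions.exists_lt_of_mem_interior {m : ℕ} {p y s : Fin m → ℝ} {μ : ℝ}
    (hμ : 0 < μ) (hs : s ∈ interior {s : Fin m → ℝ | ∀ k, |s k - p k| ≤ μ * y k}) :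
    ∃ r, 0 ≤ r ∧ r < μ ∧ ∀ k, |s k - p k| ≤ r * y k := by
  -- Push s away from p by a factor t slightly larger than 1: the image stays in the box of radius
  -- μ, so s lies in the box of radius μ / t.
  have hc : Filter.Tendsto (fun t : ℝ => p + t • (s - p)) (nhdsWithin 1 (Set.Ioi 1)) (nhds s) := by
    have h : Continuous fun t : ℝ => p + t • (s - p) := by fun_prop
    have h1 := h.tendsto 1
    rw [one_smul, add_sub_cancel] at h1
    exact h1.mono_left nhdsWithin_le_nhds
  obtain ⟨t, ht, ht1⟩ := ((hc.eventually (mem_interior_iff_mem_nhds.1 hs)).and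
    self_mem_nhdsWithin).exists
  have ht1 : (1 : ℝ) < t := ht1
  have ht0 : 0 < t := one_pos.trans ht1
  refine ⟨μ / t, by positivity, div_lt_self hμ ht1, fun k => ?_⟩
  have h := ht k
  rw [Pi.add_apply, Pi.smul_apply, Pi.sub_apply, smul_eq_mul, add_sub_cancel_left, abs_mul,
    abs_of_pos ht0] at h
  rw [div_mul_eq_mul_div, le_div_iff₀ ht0]
  linarith

/-! ### Uniformity over the parameter box. -/

open ExclusionRegions in
theorem mainTheorem1 {n m : ℕ} [NeZero n]
    -- the system `H(x, s) = 0` on `X × S`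
    (X : Set (Fin n → ℝ)) (S : Set (Fin m → ℝ))
    (H : (Fin n ⊕ Fin m → ℝ) → Fin n → ℝ)
    (hD : UniqueDiffOn ℝ (prodDomain X S))
    (hH : DifferentiableOn ℝ H (prodDomain X S))
    (hH' : ∃ K : NNReal,
      LipschitzOnWith K (fderivWithin ℝ H (prodDomain X S)) (prodDomain X S))
    -- the boxes `𝐱 = [x₁, x₂]` and `𝐬 = [s₁, s₂]`, the approximate zero `(z, p)`
    (x₁ x₂ z : Fin n → ℝ) (s₁ s₂ p : Fin m → ℝ)
    (hxX : Set.Icc x₁ x₂ ⊆ X) (hsS : Set.Icc s₁ s₂ ⊆ S)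
    (hz : z ∈ Set.Icc x₁ x₂) (hp : p ∈ Set.Icc s₁ s₂)
    -- the approximation function
    (xhat : (Fin m → ℝ) → Fin n → ℝ) (hxhat : ContDiff ℝ 1 xhat)
    (hxhat_p : xhat p = z) (hxhat_mem : ∀ s ∈ Set.Icc s₁ s₂, xhat s ∈ Set.Icc x₁ x₂)
    -- the preconditioner, and the bounds at `(z, p)`
    (C : Matrix (Fin n) (Fin n) ℝ) (b : Fin n → ℝ) (B₀ : Matrix (Fin n) (Fin n) ℝ)
    (hb : ∀ i, absVec (C.mulVec (H (Sum.elim z p))) i ≤ b i)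
    (hB₀ : ∀ i j, absMat (C * jacX H (prodDomain X S) (Sum.elim z p) - 1) i j ≤ B₀ i j)
    -- slopes, with center `p` resp. `g(p)`, for `x̂`, `C H` and `H'_x`
    (Mx : (Fin m → ℝ) → Matrix (Fin n) (Fin m) ℝ)
    (hMx : ∀ s ∈ Set.Icc s₁ s₂, IsSlope xhat p s (Mx s))
    (MH : (Fin m → ℝ) → Matrix (Fin n) (Fin n ⊕ Fin m) ℝ)
    (hMH : ∀ s ∈ Set.Icc s₁ s₂,
      IsSlope (fun q => C.mulVec (H q)) (curve xhat p) (curve xhat s) (MH s))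
    (TH : (Fin m → ℝ) → Tensor (Fin n) (Fin n) (Fin n ⊕ Fin m))
    (hTH : ∀ s ∈ Set.Icc s₁ s₂,
      IsMatrixSlope (jacX H (prodDomain X S)) (curve xhat p) (curve xhat s) (TH s))
    -- second order slopes with respect to `x`, with double center `g(s)` at `(x, s)`
    (Hxx : (Fin n → ℝ) → (Fin m → ℝ) → Tensor (Fin n) (Fin n) (Fin n))
    (hHxx : ∀ s ∈ Set.Icc s₁ s₂, ∀ x ∈ Set.Icc x₁ x₂,
      IsSecondSlope (fun x' => H (Sum.elim x' s)) (jacX H (prodDomain X S) (curve xhat s))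
        (xhat s) x (Hxx x s))
    -- the bounds `𝔅(s)` on the second order slopes, and the bounds uniform in `s`
    (Bs : (Fin m → ℝ) → Tensor (Fin n) (Fin n) (Fin n))
    (hBs : ∀ s ∈ Set.Icc s₁ s₂, ∀ x ∈ Set.Icc x₁ x₂, ∀ i j k,
      absTensor (matMulTensor C (Hxx x s)) i j k ≤ Bs s i j k)
    (Gbar : Matrix (Fin n) (Fin m) ℝ)
    (hGbar : ∀ s ∈ Set.Icc s₁ s₂, ∀ i k, slopeG₀ (MH s) (Mx s) i k ≤ Gbar i k)
    (Abar : Tensor (Fin n) (Fin n) (Fin m))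
    (hAbar : ∀ s ∈ Set.Icc s₁ s₂, ∀ i j k, slopeA C (TH s) (Mx s) i j k ≤ Abar i j k)
    (Bbar : Tensor (Fin n) (Fin n) (Fin n))
    (hBbar : ∀ s ∈ Set.Icc s₁ s₂, ∀ i j k, Bs s i j k ≤ Bbar i j k)
    -- the scaling vectors
    (v : Fin n → ℝ) (hv : ∀ j, 0 < v j) (y : Fin m → ℝ) (hy : ∀ k, 0 < y k)
    (hw : ∀ j, 0 < wVec v B₀ j)
    -- the denominators `𝔞_j(s)` and `α_j` do not vanish
    (ha : ∀ s ∈ Set.Icc s₁ s₂, ∀ j, 0 < aVec v (Bs s) j)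
    (hα : ∀ j, 0 < alpha v y Abar j)
    -- the bounds `𝔟(s)`, `𝔅₀(s)`, and their upper bounds `𝔟(μ)`, `𝔅₀(μ)` for the radius `μ`
    (bs : (Fin m → ℝ) → Fin n → ℝ)
    (hbs : ∀ s, bs s = bAt b (slopeG₀ (MH s) (Mx s)) (absVec (s - p)))
    (B₀s : (Fin m → ℝ) → Matrix (Fin n) (Fin n) ℝ)
    (hB₀s : ∀ s, B₀s s = B₀At B₀ (slopeA C (TH s) (Mx s)) (absVec (s - p)))
    (bμ : ℝ → Fin n → ℝ) (hbμ : ∀ r, bμ r = bAt b Gbar (r • y))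
    (B₀μ : ℝ → Matrix (Fin n) (Fin n) ℝ) (hB₀μ : ∀ r, B₀μ r = B₀At B₀ Abar (r • y))
    -- the radii `η` and `σ`
    (η σ : ℝ)
    (hη : IsLUB {r | r ∈ Set.Icc 0 (muMin v y b B₀ Gbar Abar Bbar) ∧
      lamI v (bμ r) (B₀μ r) Bbar < lamE v (bμ r) (B₀μ r) Bbar} η)
    (hσ : IsGreatest {r | r ∈ Set.Icc 0 (muMin v y b B₀ Gbar Abar Bbar) ∧
      ∀ s ∈ box p y r, ∀ t ∈ Set.Icc (-1 : ℝ) 1, ∀ j,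
        xhat s j + t * lamI v (bμ r) (B₀μ r) Bbar * v j ∈ Set.Icc (x₁ j) (x₂ j)} σ)
    (hμ : 0 < min η σ) :
    ∀ s ∈ interior {s | ∀ k, |s k - p k| ≤ min η σ * y k} ∩ Set.Icc s₁ s₂,
      -- the parameters `λⁱ_s < λᵉ_s` are well defined
      (∀ j, 0 < disc v (bs s) (B₀s s) (Bs s) j) ∧
      lamI v (bs s) (B₀s s) (Bs s) < lamE v (bs s) (B₀s s) (Bs s) ∧
      -- there is a zero in the inclusion region, which is contained in `𝐱`
      box (xhat s) v (lamI v (bs s) (B₀s s) (Bs s)) ⊆ Set.Icc x₁ x₂ ∧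
      (∃ x ∈ box (xhat s) v (lamI v (bs s) (B₀s s) (Bs s)), H (Sum.elim x s) = 0) ∧
      -- there are no other zeros in the interior of the exclusion region
      ∀ x ∈ interior (box (xhat s) v (lamE v (bs s) (B₀s s) (Bs s)) ∩ Set.Icc x₁ x₂) \
          box (xhat s) v (lamI v (bs s) (B₀s s) (Bs s)),
        H (Sum.elim x s) ≠ 0 := by
  have hi : ∀ s ∈ Set.Icc s₁ s₂, ∀ i j k, 0 ≤ Bs s i j k := fun s hs i j k =>
    (abs_nonneg _).trans (hBs s hs (xhat s) (hxhat_mem s hs) i j k)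
  have hG0 : ∀ i k, 0 ≤ Gbar i k := fun i k =>
    (slopeG₀_nonneg _ _ i k).trans (hGbar p hp i k)
  have hA0 : ∀ i j k, 0 ≤ Abar i j k := fun i j k =>
    (slopeA_nonneg _ _ _ i j k).trans (hAbar p hp i j k)
  have hb0 : ∀ j, 0 ≤ b j := fun j => (abs_nonneg _).trans (hb j)
  have hB₀0 : ∀ i j, 0 ≤ B₀ i j := fun i j => (abs_nonneg _).trans (hB₀ i j)
  have haB : ∀ s ∈ Set.Icc s₁ s₂, ∀ j, aVec v (Bs s) j ≤ aVec v Bbar j := fun s hs j =>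
    (le_abs_self _).trans (abs_tensorQuad_le
      (fun i k => (abs_of_nonneg (hi s hs j i k)).le.trans (hBbar s hs j i k))
      fun k => (abs_of_pos (hv k)).le)
  have habar : ∀ j, 0 < aVec v Bbar j := fun j => (ha p hp j).trans_le (haB p hp j)
  have hGy : ∀ j, 0 ≤ Gbar.mulVec y j := fun j =>
    mulVec_nonneg (hG0 j) fun k => (hy k).le
  have hwr : ∀ r j, wVec v (B₀μ r) j = wVec v B₀ j - r * alpha v y Abar j := fun r j => by
    rw [hB₀μ, wVec_apply, wVec_apply, B₀At, tensorMulVec_smul, Matrix.add_mulVec,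
      Matrix.smul_mulVec, Pi.add_apply, Pi.smul_apply, smul_eq_mul, alpha]
    ring
  have hbr : ∀ r j, bμ r j = b j + r * Gbar.mulVec y j := fun r j => by
    simp [hbμ, bAt, Matrix.mulVec_smul]
  have hdr : ∀ r j, disc v (bμ r) (B₀μ r) Bbar j = alpha v y Abar j ^ 2 * r ^ 2 -
      2 * beta v y B₀ Gbar Abar Bbar j * r + gamma v b B₀ Bbar j := fun r j => by
    rw [hbμ, hB₀μ, disc_eq_quadratic]
  have hmin : ∀ j, muMin v y b B₀ Gbar Abar Bbar ≤ muLower (alpha v y Abar j)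
      (beta v y B₀ Gbar Abar Bbar j) (gamma v b B₀ Bbar j) := fun j =>
    ciInf_le (Set.finite_range _).bddBelow j
  have hlow := fun r j (hr : r ≤ muMin v y b B₀ Gbar Abar Bbar) =>
    le_muLower (hα j) (hw j) (habar j) (hGy j) (hb0 j) (hr.trans (hmin j))
  have hw0 : ∀ r ≤ muMin v y b B₀ Gbar Abar Bbar, ∀ j, 0 ≤ wVec v (B₀μ r) j :=
    fun r hr j => by rw [hwr]; exact (hlow r j hr).1
  have hd0 : ∀ r ≤ muMin v y b B₀ Gbar Abar Bbar, ∀ j, 0 ≤ disc v (bμ r) (B₀μ r) Bbar j :=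
    fun r hr j => by rw [hdr]; exact (hlow r j hr).2.1
  have hwmono : ∀ r r', r ≤ r' → ∀ j, wVec v (B₀μ r') j ≤ wVec v (B₀μ r) j :=
    fun r r' h j => by
      rw [hwr, hwr]
      exact sub_le_sub_left (mul_le_mul_of_nonneg_right h (hα j).le) _
  have hbmono : ∀ r r', r ≤ r' → ∀ j, bμ r j ≤ bμ r' j := fun r r' h j => by
    rw [hbr, hbr]
    exact add_le_add_right (mul_le_mul_of_nonneg_right h (hGy j)) _
  have hbnn : ∀ r, 0 ≤ r → ∀ j, 0 ≤ bμ r j := fun r h j => by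
    rw [hbr]
    exact add_nonneg (hb0 j) (mul_nonneg h (hGy j))
  have hImono : ∀ r r', 0 ≤ r → r ≤ r' → r' ≤ muMin v y b B₀ Gbar Abar Bbar →
      lamI v (bμ r) (B₀μ r) Bbar ≤ lamI v (bμ r') (B₀μ r') Bbar := fun r r' h0 h h' =>
    lamI_mono fun j => lamIj_mono (habar j) le_rfl (hw0 r' h' j) (hwmono r r' h j)
      (hbnn r h0 j) (hbmono r r' h j) (hd0 r' h' j)
  have hEmono : ∀ r r', 0 ≤ r → r ≤ r' → r' ≤ muMin v y b B₀ Gbar Abar Bbar →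
      lamE v (bμ r') (B₀μ r') Bbar ≤ lamE v (bμ r) (B₀μ r) Bbar := fun r r' h0 h h' =>
    lamE_mono fun j => lamEj_anti (habar j) le_rfl (hw0 r' h' j) (hwmono r r' h j)
      (hbnn r h0 j) (hbmono r r' h j)
  rintro s ⟨hs, hsI⟩
  obtain ⟨r, hr0, hrμ, hsr⟩ := exists_lt_of_mem_interior hμ hs
  -- The supremum gives an admissible r' > r. Monotonicity carries λⁱ < λᵉ from r' down to r, and r
  -- < r' makes r strictly smaller than the smallest root, as strict positivity requires.
  obtain ⟨r', ⟨hr'I, hr'lt⟩, hrr'⟩ := (lt_isLUB_iff hη).1 (hrμ.trans_le (min_le_left _ _))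
  have hrmin : r < muMin v y b B₀ Gbar Abar Bbar := hrr'.trans_le hr'I.2
  have hwr0 : ∀ j, 0 < wVec v (B₀μ r) j := fun j => by
    rw [hwr]; exact ((hlow r j hrmin.le).2.2 (hrmin.trans_le (hmin j))).1
  have hdr0 : ∀ j, 0 < disc v (bμ r) (B₀μ r) Bbar j := fun j => by
    rw [hdr]; exact ((hlow r j hrmin.le).2.2 (hrmin.trans_le (hmin j))).2
  have hltr : lamI v (bμ r) (B₀μ r) Bbar < lamE v (bμ r) (B₀μ r) Bbar :=
    (hImono r r' hr0 hrr'.le hr'I.2).trans_lt (hr'lt.trans_le (hEmono r r' hr0 hrr'.le hr'I.2))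
  have habs : ∀ k, absVec (s - p) k ≤ (r • y) k := hsr
  have hbs0 : ∀ j, |C.mulVec (H (curve xhat s)) j| ≤ bs s j := fun j => by
    rw [hbs]
    refine abs_apply_curve_le_bAt (F := fun q => C.mulVec (H q)) (hMx s hsI) (hMH s hsI)
      (fun i => ?_) j
    rw [curve, hxhat_p]
    exact hb i
  have hB₀s0 : ∀ i j, |(C * jacX H (prodDomain X S) (curve xhat s) - 1) i j| ≤ B₀s s i j := by
    rw [hB₀s]
    refine abs_mul_sub_one_le_B₀At (hMx s hsI) (hTH s hsI) fun i j => ?_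
    rw [curve, hxhat_p]
    exact hB₀ i j
  have hbsr : ∀ j, bs s j ≤ bμ r j := fun j => by
    rw [hbs, hbμ]
    exact add_le_add_right (mulVec_le_mulVec (hGbar s hsI j) (hG0 j)
      (fun _ => abs_nonneg _) habs) _
  have hwsr : ∀ j, wVec v (B₀μ r) j ≤ wVec v (B₀s s) j := fun j => by
    rw [hB₀s, hB₀μ, wVec_apply, wVec_apply]
    refine sub_le_sub_left (mulVec_le_mulVec (fun k => ?_) (fun k => ?_)
      (fun k => (hv k).le) fun _ => le_rfl) _
    · exact add_le_add_right (tensorMulVec_le_tensorMulVec (hAbar s hsI j k) (hA0 j k)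
        (fun _ => abs_nonneg _) habs) _
    · exact add_nonneg (hB₀0 j k) (tensorMulVec_nonneg (hA0 j k) fun l =>
        mul_nonneg hr0 (hy l).le)
  have hbsnn : ∀ j, 0 ≤ bs s j := fun j => (abs_nonneg _).trans (hbs0 j)
  have hds : ∀ j, 0 < disc v (bs s) (B₀s s) (Bs s) j := fun j => (hdr0 j).trans_le
    (disc_anti (ha s hsI j).le (haB s hsI j) (hwr0 j).le (hwsr j) (hbsnn j) (hbsr j))
  have hIs : lamI v (bs s) (B₀s s) (Bs s) ≤ lamI v (bμ r) (B₀μ r) Bbar :=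
    lamI_mono fun j => lamIj_mono (ha s hsI j) (haB s hsI j) (hwr0 j).le (hwsr j) (hbsnn j)
      (hbsr j) (hdr0 j).le
  have hEs : lamE v (bμ r) (B₀μ r) Bbar ≤ lamE v (bs s) (B₀s s) (Bs s) :=
    lamE_mono fun j => lamEj_anti (ha s hsI j) (haB s hsI j) (hwr0 j).le (hwsr j) (hbsnn j)
      (hbsr j)
  have hlts := hIs.trans_lt (hltr.trans_le hEs)
  have hrσ : r ≤ σ := hrμ.le.trans (min_le_right _ _)
  -- The inclusion radius at s is at most the one at r, hence at most the one at σ, whose boxes lie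
  -- in 𝐱 by the choice of σ.
  have hIσ := hIs.trans (hImono r σ hr0 hrσ hσ.1.1.2)
  have hsσ : s ∈ box p y σ := mem_box_iff.2 fun k =>
    (hsr k).trans (mul_le_mul_of_nonneg_right hrσ (hy k).le)
  have hsub : box (xhat s) v (lamI v (bs s) (B₀s s) (Bs s)) ⊆ Set.Icc x₁ x₂ := by
    intro x hx
    have hxj : ∀ j, |x j - xhat s j| ≤ lamI v (bμ σ) (B₀μ σ) Bbar * v j := fun j =>
      (mem_box_iff.1 hx j).trans (mul_le_mul_of_nonneg_right hIσ (hv j).le)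
    refine ⟨fun j => ?_, fun j => ?_⟩
    · have h1 := (hσ.1.2 s hsσ (-1) (by norm_num) j).1
      linarith [(abs_le.1 (hxj j)).1]
    · have h1 := (hσ.1.2 s hsσ 1 (by norm_num) j).2
      linarith [(abs_le.1 (hxj j)).2]
  have hcont : ContinuousOn (fun x => H (Sum.elim x s)) (Set.Icc x₁ x₂) :=
    hH.continuousOn.comp (Continuous.continuousOn (continuous_pi fun i => by
        cases i <;> simp only [Sum.elim_inl, Sum.elim_inr] <;> fun_prop))
      fun x hx => ⟨hxX hx, hsS hsI⟩
  exact ⟨hds, hlts, hsub, exists_zero_and_ne_zero hv hcont hbs0 hB₀s0 (hHxx s hsI) (hBs s hsI)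
    (fun j => (hwr0 j).trans_le (hwsr j)) (ha s hsI) hds hlts hsub⟩
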